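/- Let $I=[0,1]$ and let $C(I)$ be the set of continuous surjective maps $I\to I$, with the uniform metric $\rho(f,g)=\sup_{x\in I}|f(x)-g(x)|$. Let $CP\subset C(I)$ be the set of maps whose periodic points are dense in $I$, and let $\overline{CP}$ be its closure in $C(I)$. Then for every $f\in\overline{CP}$ the conjugacy class $$G_f=\{\psi^{-1}\circ f\circ\psi : \psi \text{ a homeomorphism (increasing or decreasing) of } I\}$$ is a subset of $\overline{CP}$ and is nowhere dense in $\overline{CP}$; that is, the closure of $G_f$ in $\overline{CP}$ has empty interior in the subspace $\overline{CP}$. -/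

import Mathlib

/-- The class `CP` of continuous surjective self-maps of the unit interval `I = [0,1]` whose
periodic points (of arbitrary positive period) are dense in `I`.
It is a subset of `C(I, I)`, whose topology is that of the uniform metric
`dist f g = sup_x |f x - g x|`. Uniform limits of surjective self-maps of the compact space `I` are
surjective, so `closure CP` is the same whether it is taken in `C(I, I)` or in its subspace of
surjective maps. -/
def CP : Set C(unitInterval, unitInterval) :=
  {f | Function.Surjective f ∧ Dense (Function.periodicPts f)}

/-- The conjugacy class `G_f = {ψ⁻¹ ∘ f ∘ ψ : ψ a (increasing or decreasing) homeomorphism of I}`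
of a map `f`. -/
def conjugacyClass (f : C(unitInterval, unitInterval)) : Set C(unitInterval, unitInterval) :=
  {g | ∃ ψ : unitInterval ≃ₜ unitInterval, ∀ x, g x = ψ.symm (f (ψ x))}

/-!
Two facts carry the proof. Conjugating `f` by an increasing homeomorphism of `I` preserves the order
type of the forward orbit of the endpoint `0`; conjugating by a decreasing one turns the orbit of
`1` upside down. So the orbit of `0` has at most two order types on the conjugacy class of `f`
(`exists_orbit_order_of_mem_conjugacyClass`), and a strict inequality between two points of this
orbit is an open condition on the map. On the other hand, near every map in the closure of `CP`
there are two maps in `CP` whose orbits of `0` satisfy opposite strict inequalities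
(`exists_iterate_zero_lt_and_gt`). Applying this twice gives, in any nonempty open subset of the
closure, three nonempty open subsets whose members pairwise order the orbit of `0` differently. At
most two of them meet the conjugacy class, which is therefore not dense in the given open set.

The perturbations are built as follows. Let `g` have dense periodic points, so that `g` permutes
finite sets that are as dense as desired. Adding a high-frequency triangle wave to a Lipschitz
approximation of `g` and folding the result back into `I` gives a map `h` that expands short
intervals, while the image of a long interval `J` contains a fixed neighbourhood of `g '' J`
(`exists_isFolding`). Under iteration, an interval first becomes long; afterwards each further image
contains more points of the permuted set, until it is all of `I` (`IsFolding.isLeo`). In particular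
`h` is in `CP`. The same holds after `h` is replaced by a steep affine map on a tiny interval
`[0, δ]`, which allows its value `v` at `0` to be chosen freely from some interval
(`IsFolding.exists_apply_zero_eq`). That interval is eventually mapped onto `I`, so `v` can be
chosen such that a later iterate `y` of `0` satisfies `y < h y`, or such that it satisfies `h y < y`.
-/

open Set Function unitInterval

/-! ### Locally eventually onto maps -/

/-- A self-map of the unit interval is locally eventually onto if every nondegenerate closed
interval is mapped onto the whole of `I` by some iterate. -/
def IsLeo (h : I → I) : Prop :=
  ∀ a b : I, a < b → ∃ n : ℕ, h^[n] '' Icc a b = univ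

theorem IsLeo.surjective {h : I → I} (H : IsLeo h) : Surjective h := by
  have hlt : (0 : I) < ⟨1 / 2, by norm_num, by norm_num⟩ := by
    rw [← Subtype.coe_lt_coe]; norm_num
  obtain ⟨n, hn⟩ := H _ _ hlt
  rcases n with _ | n
  · have h1 : (1 : I) ∈ h^[0] '' Icc 0 ⟨1 / 2, by norm_num, by norm_num⟩ := hn ▸ mem_univ _
    simp only [iterate_zero, image_id] at h1
    have := Subtype.coe_le_coe.2 h1.2
    norm_num at this
  · intro y
    obtain ⟨x, -, hx⟩ : y ∈ h^[n + 1] '' _ := hn ▸ mem_univ y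
    exact ⟨h^[n] x, by rw [← hx, iterate_succ_apply']⟩

theorem IsLeo.exists_forall_ge {h : I → I} (H : IsLeo h) {a b : I} (hab : a < b) :
    ∃ n : ℕ, ∀ m ≥ n, h^[m] '' Icc a b = univ := by
  obtain ⟨n, hn⟩ := H a b hab
  refine ⟨n, fun m hm => ?_⟩
  obtain ⟨k, rfl⟩ := Nat.exists_eq_add_of_le' hm
  rw [iterate_add, image_comp, hn, image_univ, (H.surjective.iterate k).range_eq]

theorem exists_Icc_subset_of_isOpen {U : Set I} (hU : IsOpen U) (hne : U.Nonempty) :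
    ∃ a b : I, a < b ∧ Icc a b ⊆ U := by
  obtain ⟨a, b, hab, h⟩ := hU.exists_Ioo_subset hne
  obtain ⟨c, hac, hcb⟩ := exists_between hab
  obtain ⟨d, hcd, hdb⟩ := exists_between hcb
  exact ⟨c, d, hcd, (Icc_subset_Ioo hac hdb).trans h⟩

/-- An interval covered by its own image under an iterate contains a periodic point. -/
theorem IsLeo.mem_CP {h : C(I, I)} (H : IsLeo h) : h ∈ CP := by
  refine ⟨H.surjective, dense_iff_inter_open.2 fun U hU hne => ?_⟩
  obtain ⟨a, b, hab, hsub⟩ := exists_Icc_subset_of_isOpen hU hne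
  obtain ⟨n, hn⟩ := H.exists_forall_ge hab
  have hn1 := hn (n + 1) n.le_succ
  have hcont : Continuous h^[n + 1] := h.continuous.iterate _
  obtain ⟨x, hx, hxa⟩ : a ∈ h^[n + 1] '' Icc a b := hn1 ▸ mem_univ a
  obtain ⟨y, hy, hyb⟩ : b ∈ h^[n + 1] '' Icc a b := hn1 ▸ mem_univ b
  obtain ⟨z, hz, hfix⟩ := exists_mem_uIcc_isFixedPt (a := y) (b := x) hcont.continuousOn
    (hyb ▸ hy.2) (hxa ▸ hx.1)
  exact ⟨z, hsub (uIcc_subset_Icc hy hx hz), n + 1, n.succ_pos, hfix⟩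

theorem IsLeo.exists_lt_apply {h : C(I, I)} (H : IsLeo h) : ∃ x, x < h x := by
  by_contra! hcon
  obtain ⟨m, h0, h1⟩ := exists_between (zero_lt_one (α := I))
  obtain ⟨n, hn⟩ := H 0 m h0
  have key : ∀ k, ∀ x ≤ m, h^[k] x ≤ m := by
    intro k
    induction k with
    | zero => exact fun x hx => hx
    | succ k ih => exact fun x hx => ih _ ((hcon x).trans hx)
  obtain ⟨x, hx, hx1⟩ : (1 : I) ∈ h^[n] '' Icc 0 m := hn ▸ mem_univ _
  exact absurd (hx1 ▸ key n x hx.2) (not_le.2 h1)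

theorem IsLeo.exists_apply_lt {h : C(I, I)} (H : IsLeo h) : ∃ x, h x < x := by
  by_contra! hcon
  obtain ⟨m, h0, h1⟩ := exists_between (zero_lt_one (α := I))
  obtain ⟨n, hn⟩ := H m 1 h1
  have key : ∀ k, ∀ x, m ≤ x → m ≤ h^[k] x := by
    intro k
    induction k with
    | zero => exact fun x hx => hx
    | succ k ih => exact fun x hx => ih _ (hx.trans (hcon x))
  obtain ⟨x, hx, hx1⟩ : (0 : I) ∈ h^[n] '' Icc m 1 := hn ▸ mem_univ _
  exact absurd (hx1 ▸ key n x hx.1) (not_le.2 h0)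

/-- A generic orbit avoids `c`: no iterate is constant on an interval, so Baire's theorem applies. -/
theorem IsLeo.dense_forall_iterate_ne {h : C(I, I)} (H : IsLeo h) (c : I) :
    Dense {v : I | ∀ j : ℕ, h^[j] v ≠ c} := by
  have hset : {v : I | ∀ j : ℕ, h^[j] v ≠ c} = ⋂ j : ℕ, {v | h^[j] v ≠ c} := by
    ext; simp
  rw [hset]
  refine dense_iInter_of_isOpen (fun j => ?_) fun j => dense_iff_inter_open.2 fun U hU hne => ?_
  · exact isOpen_ne_fun (h.continuous.iterate j) continuous_const
  · obtain ⟨a, b, hab, hsub⟩ := exists_Icc_subset_of_isOpen hU hne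
    by_contra hemp
    obtain ⟨n, hn⟩ := H.exists_forall_ge hab
    -- If `h^[j]` were constant on `[a, b]`, then so would be `h^[n + j]`, which is onto there.
    have hconst : ∀ x ∈ Icc a b, h^[n + j] x = h^[n] c := by
      intro x hx
      have : h^[j] x = c := by
        by_contra hne'
        exact hemp ⟨x, hsub hx, hne'⟩
      rw [iterate_add_apply, this]
    have huniv := hn (n + j) (Nat.le_add_right _ _)
    obtain ⟨x, hx, hx0⟩ : (0 : I) ∈ h^[n + j] '' Icc a b := huniv ▸ mem_univ _
    obtain ⟨y, hy, hy1⟩ : (1 : I) ∈ h^[n + j] '' Icc a b := huniv ▸ mem_univ _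
    exact zero_ne_one (α := I) (by rw [← hx0, ← hy1, hconst x hx, hconst y hy])

/-! ### A criterion for being locally eventually onto -/

/-- If `g` has dense periodic points, then arbitrarily dense finite sets are permuted by `g`. -/
theorem exists_finset_mapsTo_injOn {g : C(I, I)} (hg : g ∈ CP) {r : ℝ} (hr : 0 < r) :
    ∃ P : Finset I, (∀ p ∈ P, g p ∈ P) ∧ InjOn g P ∧ ∀ x : I, ∃ p ∈ P, |(x : ℝ) - p| < r := by
  classical
  obtain ⟨t, ht, hcov⟩ := isCompact_univ.elim_finite_subcover_image
    (b := periodicPts g) (c := fun p : I => Metric.ball p r) (fun _ _ => Metric.isOpen_ball)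
    (fun x _ => by
      obtain ⟨p, hp, hd⟩ := hg.2.exists_dist_lt x hr
      exact mem_biUnion hp hd)
  obtain ⟨htfin, hcov⟩ := hcov
  have hfin : (⋃ p ∈ t, range fun k : ℕ => g^[k] p).Finite := by
    refine htfin.biUnion fun p hp => ?_
    refine ((finite_Iio (minimalPeriod g p)).image fun k : ℕ => g^[k] p).subset ?_
    rintro _ ⟨k, rfl⟩
    exact ⟨k % minimalPeriod g p, Nat.mod_lt _ (minimalPeriod_pos_of_mem_periodicPts (ht hp)),
      iterate_mod_minimalPeriod_eq⟩
  refine ⟨hfin.toFinset, ?_, ?_, fun x => ?_⟩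
  · intro x hx
    simp only [Finite.mem_toFinset, mem_iUnion, mem_range] at hx ⊢
    obtain ⟨p, hp, k, rfl⟩ := hx
    exact ⟨p, hp, k + 1, iterate_succ_apply' _ _ _⟩
  · refine (bijOn_periodicPts g).injOn.mono fun x hx => ?_
    simp only [Finite.coe_toFinset, mem_iUnion, mem_range] at hx
    obtain ⟨p, hp, k, rfl⟩ := hx
    exact ((bijOn_periodicPts g).mapsTo.iterate k) (ht hp)
  · obtain ⟨p, hp, hx⟩ := mem_iUnion₂.1 (hcov (mem_univ x))
    refine ⟨p, ?_, hx⟩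
    simp only [Finite.mem_toFinset, mem_iUnion, mem_range]
    exact ⟨p, hp, 0, rfl⟩

theorem Icc_apply_subset_image {h : I → I} (hc : Continuous h) {a b x y : I} (hx : x ∈ Icc a b)
    (hy : y ∈ Icc a b) : Icc (h x) (h y) ⊆ h '' Icc a b :=
  isPreconnected_Icc.intermediate_value hx hy hc.continuousOn

theorem iterate_succ_image_eq_univ {h : I → I} {a b c d : I} (hsub : Icc c d ⊆ h '' Icc a b)
    {n : ℕ} (hn : h^[n] '' Icc c d = univ) : h^[n + 1] '' Icc a b = univ := by
  rw [iterate_succ, image_comp]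
  exact univ_subset_iff.1 (hn ▸ image_mono hsub)

/-- `h` is a folded version of `g`: it expands intervals of length at most `l` by the factor `k`,
while the image under `h` of an interval `J` of length at least `m` contains all points of `I` at
distance at most `r` from `g '' J`. The two length scales `l` and `m` are separate so that some room
is left for modifying `h`. -/
structure IsFolding (h g : I → I) (k l m r : ℝ) : Prop where
  short : ∀ a b : I, a < b → (b : ℝ) - a ≤ l →
    ∃ x ∈ Icc a b, ∃ y ∈ Icc a b, k * ((b : ℝ) - a) ≤ (h y : ℝ) - h x
  long : ∀ a b : I, m ≤ (b : ℝ) - a → ∀ x ∈ Icc a b, ∀ y : I, |(y : ℝ) - g x| ≤ r →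
    y ∈ h '' Icc a b

/-- Passing from a long interval to its image under a folded version of `g` strictly increases the
number of points of a finite set permuted by `g`, as long as the image is not the whole of `I`. -/
theorem IsFolding.exists_image_card_lt {h g : I → I} {k l m r : ℝ} (H : IsFolding h g k l m r)
    (hc : Continuous h) (hm : 0 < m) (hmr : m ≤ r) (hr : r ≤ 1 / 2) {P : Finset I}
    (hP : ∀ p ∈ P, g p ∈ P) (hinj : InjOn g P) (hdense : ∀ x : I, ∃ p ∈ P, |(x : ℝ) - p| < r / 2)
    {a b : I} (hab : m ≤ (b : ℝ) - a) :
    ∃ c d : I, m ≤ (d : ℝ) - c ∧ Icc c d ⊆ h '' Icc a b ∧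
      (Icc c d = univ ∨ {p ∈ P | p ∈ Icc a b}.card < {p ∈ P | p ∈ Icc c d}.card) := by
  have hle : a ≤ b := by
    rw [← Subtype.coe_le_coe]; linarith
  have hne : (Icc a b).Nonempty := nonempty_Icc.2 hle
  obtain ⟨x₀, hx₀, hmin⟩ := isCompact_Icc.exists_isMinOn hne hc.continuousOn
  obtain ⟨x₁, hx₁, hmax⟩ := isCompact_Icc.exists_isMaxOn hne hc.continuousOn
  set c := h x₀
  set d := h x₁
  have himg : ∀ x ∈ Icc a b, ∀ y : I, |(y : ℝ) - g x| ≤ r → (c : ℝ) ≤ y ∧ (y : ℝ) ≤ d := by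
    intro x hx y hy
    obtain ⟨z, hz, rfl⟩ := H.long a b hab x hx y hy
    exact ⟨hmin hz, hmax hz⟩
  have hr0 : 0 < r := hm.trans_le hmr
  have ha : a ∈ Icc a b := ⟨le_rfl, hle⟩
  have hg : ∀ x ∈ Icc a b, (c : ℝ) ≤ g x ∧ (g x : ℝ) ≤ d := fun x hx =>
    himg x hx _ (by rw [sub_self, abs_zero]; exact hr0.le)
  have hlow : (0 : ℝ) < c → ∀ x ∈ Icc a b, (c : ℝ) + r ≤ g x := by
    intro hc0 x hx
    by_contra! hlt
    have := (himg x hx ⟨max (g x - r) 0, le_max_right _ _,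
      max_le (by linarith [(g x).2.2]) zero_le_one⟩ (by
        have := (g x).2.1
        rw [abs_le]
        constructor
        · linarith [le_max_left ((g x : ℝ) - r) 0]
        · linarith [max_le (by linarith : (g x : ℝ) - r ≤ g x) this])).1
    exact absurd this (not_le.2 (max_lt (by linarith) hc0))
  have hhigh : (d : ℝ) < 1 → ∀ x ∈ Icc a b, (g x : ℝ) + r ≤ d := by
    intro hc0 x hx
    by_contra! hlt
    have := (himg x hx ⟨min (g x + r) 1, le_min (by linarith [(g x).2.1]) zero_le_one,
      min_le_right _ _⟩ (by
        have := (g x).2.2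
        rw [abs_le]
        constructor
        · linarith [le_min (by linarith : (g x : ℝ) ≤ g x + r) this]
        · linarith [min_le_left ((g x : ℝ) + r) 1])).2
    exact absurd this (not_le.2 (lt_min (by linarith) hc0))
  have hcard : ∀ p ∈ P, p ∈ Icc c d → (∀ x ∈ Icc a b, g x ≠ p) →
      {p ∈ P | p ∈ Icc a b}.card < {p ∈ P | p ∈ Icc c d}.card := by
    classical
    intro p hpP hp hpne
    rw [← Finset.card_image_of_injOn
      (hinj.mono fun x hx => (Finset.mem_filter.1 (Finset.mem_coe.1 hx)).1)]
    refine Finset.card_lt_card ((Finset.ssubset_iff_of_subset ?_).2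
      ⟨p, Finset.mem_filter.2 ⟨hpP, hp⟩, ?_⟩)
    · intro y hy
      obtain ⟨x, hx, rfl⟩ := Finset.mem_image.1 hy
      rw [Finset.mem_filter] at hx
      exact Finset.mem_filter.2 ⟨hP x hx.1, hg x hx.2⟩
    · intro hp'
      obtain ⟨x, hx, hxp⟩ := Finset.mem_image.1 hp'
      exact hpne x (Finset.mem_filter.1 hx).2 hxp
  refine ⟨c, d, ?_, Icc_apply_subset_image hc hx₀ hx₁, ?_⟩
  · have h1 := hg a ha
    rcases le_total ((g a : ℝ)) (1 / 2) with h2 | h2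
    · have := (himg a ha ⟨g a + r, by linarith [(g a).2.1], by linarith⟩
        (by simp [abs_of_pos hr0])).2
      simp only at this
      linarith
    · have := (himg a ha ⟨g a - r, by linarith, by linarith [(g a).2.2]⟩
        (by simp [abs_of_pos hr0])).1
      simp only at this
      linarith
  · rcases c.2.1.eq_or_lt with hc0 | hc0
    · rcases d.2.2.eq_or_lt with hd1 | hd1
      · left
        refine eq_univ_of_forall fun x => ⟨?_, ?_⟩
        · rw [← Subtype.coe_le_coe, ← hc0]; exact x.2.1
        · rw [← Subtype.coe_le_coe, hd1]; exact x.2.2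
      · right
        obtain ⟨p, hpP, hp⟩ := hdense ⟨d - r / 2, by linarith [hhigh hd1 a ha, (g a).2.1],
          by linarith⟩
        rw [abs_lt] at hp
        simp only at hp
        refine hcard p hpP ⟨?_, ?_⟩ fun x hx hxp => ?_
        · rw [← Subtype.coe_le_coe]; linarith [hhigh hd1 a ha, hg a ha]
        · rw [← Subtype.coe_le_coe]; linarith
        · have := hhigh hd1 x hx
          rw [hxp] at this
          linarith
    · right
      obtain ⟨p, hpP, hp⟩ := hdense ⟨c + r / 2, by linarith, by linarith [hlow hc0 a ha, (g a).2.2]⟩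
      rw [abs_lt] at hp
      simp only at hp
      refine hcard p hpP ⟨?_, ?_⟩ fun x hx hxp => ?_
      · rw [← Subtype.coe_le_coe]; linarith
      · rw [← Subtype.coe_le_coe]; linarith [hlow hc0 a ha, hg a ha]
      · have := hlow hc0 x hx
        rw [hxp] at this
        linarith

/-- Short intervals grow exponentially under iteration until they are long; from then on their
images pick up additional points of a finite set permuted by `g` until they fill `I`. -/
theorem IsFolding.isLeo {h : I → I} {g : C(I, I)} {l r : ℝ} (H : IsFolding h g 2 l l r)
    (hc : Continuous h) (hg : g ∈ CP) (hl : 0 < l) (hlr : l ≤ r) (hr : r ≤ 1 / 2) : IsLeo h := by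
  obtain ⟨P, hP, hinj, hdense⟩ := exists_finset_mapsTo_injOn hg (half_pos (hl.trans_le hlr))
  -- The induction is on the number of points of `P` that are still missing.
  have hlong : ∀ k : ℕ, ∀ a b : I, l ≤ (b : ℝ) - a → P.card < {p ∈ P | p ∈ Icc a b}.card + k →
      ∃ n : ℕ, h^[n] '' Icc a b = univ := by
    intro k
    induction k with
    | zero => exact fun a b _ hk => absurd (Finset.card_filter_le P _) (not_le.2 hk)
    | succ k ih =>
      intro a b hab hk
      obtain ⟨c, d, hcd, hsub, huniv | hlt⟩ :=
        H.exists_image_card_lt hc hl hlr hr hP hinj hdense hab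
      · exact ⟨1, iterate_succ_image_eq_univ hsub (n := 0) (by simpa using huniv)⟩
      · obtain ⟨n, hn⟩ := ih c d hcd (by omega)
        exact ⟨n + 1, iterate_succ_image_eq_univ hsub hn⟩
  have hgrow : ∀ k : ℕ, ∀ a b : I, a < b → l ≤ 2 ^ k * ((b : ℝ) - a) →
      ∃ n : ℕ, h^[n] '' Icc a b = univ := by
    intro k
    induction k with
    | zero =>
      intro a b _ hk
      exact hlong (P.card + 1) a b (by simpa using hk) (by omega)
    | succ k ih =>
      intro a b hab hk
      rcases le_total l ((b : ℝ) - a) with hle | hle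
      · exact hlong (P.card + 1) a b hle (by omega)
      · obtain ⟨x, hx, y, hy, hxy⟩ := H.short a b hab hle
        have hpos : (0 : ℝ) < b - a := sub_pos.2 hab
        have hlt : h x < h y := by
          rw [← Subtype.coe_lt_coe]; linarith
        obtain ⟨n, hn⟩ := ih (h x) (h y) hlt (by
          rw [pow_succ, mul_assoc] at hk
          exact hk.trans (mul_le_mul_of_nonneg_left hxy (by positivity)))
        exact ⟨n + 1, iterate_succ_image_eq_univ (Icc_apply_subset_image hc hx hy) hn⟩
  intro a b hab
  have hpos : (0 : ℝ) < b - a := sub_pos.2 hab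
  obtain ⟨k, hk⟩ := pow_unbounded_of_one_lt (l / ((b : ℝ) - a)) (one_lt_two (α := ℝ))
  exact hgrow k a b hab ((div_lt_iff₀ hpos).1 hk).le

/-! ### Folded approximations of continuous maps -/

/-- The distance from a real number to the nearest integer: a triangle wave of period `1` with
slopes `1` and `-1` and values in `[0, 1/2]`. -/
noncomputable def triangleWave (x : ℝ) : ℝ := ‖(x : UnitAddCircle)‖

theorem continuous_triangleWave : Continuous triangleWave :=
  continuous_norm.comp (AddCircle.continuous_mk' 1)

theorem triangleWave_eq_min {x : ℝ} (m : ℤ) (h₀ : (m : ℝ) ≤ x) (h₁ : x ≤ m + 1) :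
    triangleWave x = min (x - m) (m + 1 - x) := by
  rw [triangleWave, UnitAddCircle.norm_eq, abs_sub_round_eq_min]
  rcases h₁.lt_or_eq with h | rfl
  · have : ⌊x⌋ = m := Int.floor_eq_iff.2 ⟨h₀, h⟩
    rw [Int.fract, this]
    congr 1
    ring
  · simp

theorem triangleWave_nonneg (x : ℝ) : 0 ≤ triangleWave x := norm_nonneg _

theorem triangleWave_le_half (x : ℝ) : triangleWave x ≤ 1 / 2 := by
  rw [triangleWave, UnitAddCircle.norm_eq]
  exact abs_sub_round x

theorem exists_triangleWave_eq_zero (s : ℝ) : ∃ x ∈ Icc s (s + 1), triangleWave x = 0 := by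
  refine ⟨⌈s⌉, ⟨Int.le_ceil s, (Int.ceil_lt_add_one s).le⟩, ?_⟩
  rw [triangleWave_eq_min ⌈s⌉ le_rfl (by linarith)]
  simp

theorem exists_triangleWave_eq_half (s : ℝ) : ∃ x ∈ Icc s (s + 1), triangleWave x = 1 / 2 := by
  have h1 := Int.le_ceil (s - 1 / 2)
  have h2 := Int.ceil_lt_add_one (s - 1 / 2)
  refine ⟨⌈s - 1 / 2⌉ + 1 / 2, ⟨by linarith, by linarith⟩, ?_⟩
  rw [triangleWave_eq_min ⌈s - 1 / 2⌉ (by linarith) (by linarith), min_eq_left (by linarith)]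
  ring

/-- Of two adjacent short intervals of equal length, one contains no turning point of the triangle
wave. -/
theorem exists_abs_triangleWave_sub (a : ℝ) {s : ℝ} (hs : 0 ≤ s) (hs' : s ≤ 1 / 4) :
    ∃ c, (c = a ∨ c = a + s) ∧ |triangleWave (c + s) - triangleWave c| = s := by
  have h0 := Int.floor_le a
  have h1 := Int.lt_floor_add_one a
  set m := ⌊a⌋
  rcases lt_or_ge (a - m) (1 / 2) with h | h
  · rcases le_total (a - m + s) (1 / 2) with h' | h'
    · refine ⟨a, .inl rfl, ?_⟩
      rw [triangleWave_eq_min m (by linarith) (by linarith), triangleWave_eq_min m h0 h1.le,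
        min_eq_left (by linarith), min_eq_left (by linarith), abs_of_nonneg (by linarith)]
      ring
    · refine ⟨a + s, .inr rfl, ?_⟩
      rw [triangleWave_eq_min m (by linarith) (by linarith),
        triangleWave_eq_min m (by linarith) (by linarith),
        min_eq_right (by linarith), min_eq_right (by linarith), abs_of_nonpos (by linarith)]
      ring
  · rcases le_total (a - m + s) 1 with h' | h'
    · refine ⟨a, .inl rfl, ?_⟩
      rw [triangleWave_eq_min m (by linarith) (by linarith), triangleWave_eq_min m h0 h1.le,
        min_eq_right (by linarith), min_eq_right (by linarith), abs_of_nonpos (by linarith)]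
      ring
    · refine ⟨a + s, .inr rfl, ?_⟩
      have hm : ((m + 1 : ℤ) : ℝ) = m + 1 := by push_cast; ring
      rw [triangleWave_eq_min (m + 1) (by linarith) (by linarith),
        triangleWave_eq_min (m + 1) (by linarith) (by linarith),
        min_eq_left (by linarith), min_eq_left (by linarith), abs_of_nonneg (by linarith)]
      ring

/-- The map folding `[-1, 2]` onto `[0, 1]` by reflection in the endpoints `0` and `1`. -/
def fold (y : ℝ) : ℝ := 1 - |(1 - |y|)|

theorem continuous_fold : Continuous fold := by
  unfold fold; fun_prop

theorem fold_of_mem {y : ℝ} (hy : y ∈ I) : fold y = y := by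
  rw [fold, abs_of_nonneg hy.1, abs_of_nonneg (by linarith [hy.2])]; ring

theorem abs_fold_sub_le (y z : ℝ) : |fold y - fold z| ≤ |y - z| := by
  have h1 := abs_abs_sub_abs_le (1 - |z|) (1 - |y|)
  have h2 := abs_abs_sub_abs_le y z
  rw [show (1 - |z|) - (1 - |y|) = |y| - |z| by ring] at h1
  rw [fold, fold, show 1 - |(1 - |y|)| - (1 - |(1 - |z|)|) = |(1 - |z|)| - |(1 - |y|)| by ring]
  exact h1.trans h2

theorem fold_mem {y : ℝ} (h₀ : -1 ≤ y) (h₁ : y ≤ 2) : fold y ∈ I := by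
  have : |y| ≤ 2 := abs_le.2 ⟨by linarith, h₁⟩
  have h' : |(1 - |y|)| ≤ 1 := abs_le.2 ⟨by linarith, by linarith [abs_nonneg y]⟩
  exact ⟨by rw [fold]; linarith, by rw [fold]; linarith [abs_nonneg (1 - |y|)]⟩

theorem fold_of_nonpos {y : ℝ} (h₀ : -1 ≤ y) (h₁ : y ≤ 0) : fold y = -y := by
  rw [fold, abs_of_nonpos h₁, abs_of_nonneg (by linarith)]; ring

theorem fold_of_one_le {y : ℝ} (h₀ : 1 ≤ y) : fold y = 2 - y := by
  rw [fold, abs_of_nonneg (zero_le_one.trans h₀), abs_of_nonpos (by linarith)]; ring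

/-- Folding at most halves the length of an interval, since the longest part between fold points
is mapped isometrically. -/
theorem exists_fold_sub_ge {p q : ℝ} (hpq : p ≤ q) (hp : -1 / 2 ≤ p) (hq : q ≤ 3 / 2) :
    ∃ x ∈ Icc p q, ∃ y ∈ Icc p q, (q - p) / 2 ≤ fold y - fold x := by
  have hpm : p ∈ Icc p q := ⟨le_rfl, hpq⟩
  have hqm : q ∈ Icc p q := ⟨hpq, le_rfl⟩
  rcases le_total p 0 with hp0 | hp0
  · rcases le_total q 0 with hq0 | hq0
    · exact ⟨q, hqm, p, hpm, by
        rw [fold_of_nonpos (by linarith) hp0, fold_of_nonpos (by linarith) hq0]; linarith⟩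
    · have h0 : (0 : ℝ) ∈ Icc p q := ⟨hp0, hq0⟩
      have hf0 : fold 0 = 0 := fold_of_mem ⟨le_rfl, zero_le_one⟩
      rcases le_total q 1 with hq1 | hq1
      · rcases le_total (-p) q with h | h
        · exact ⟨0, h0, q, hqm, by rw [hf0, fold_of_mem ⟨hq0, hq1⟩]; linarith⟩
        · exact ⟨0, h0, p, hpm, by rw [hf0, fold_of_nonpos (by linarith) hp0]; linarith⟩
      · exact ⟨0, h0, 1, ⟨by linarith, hq1⟩, by
          rw [hf0, fold_of_mem ⟨zero_le_one, le_rfl⟩]; linarith⟩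
  · rcases le_total q 1 with hq1 | hq1
    · exact ⟨p, hpm, q, hqm, by
        rw [fold_of_mem ⟨hp0, by linarith⟩, fold_of_mem ⟨by linarith, hq1⟩]; linarith⟩
    · rcases le_total p 1 with hp1 | hp1
      · have h1 : (1 : ℝ) ∈ Icc p q := ⟨hp1, hq1⟩
        have hf1 : fold 1 = 1 := fold_of_mem ⟨zero_le_one, le_rfl⟩
        rcases le_total (1 - p) (q - 1) with h | h
        · exact ⟨q, hqm, 1, h1, by rw [hf1, fold_of_one_le hq1]; linarith⟩
        · exact ⟨p, hpm, 1, h1, by rw [hf1, fold_of_mem ⟨hp0, hp1⟩]; linarith⟩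
      · exact ⟨q, hqm, p, hpm, by rw [fold_of_one_le hp1, fold_of_one_le hq1]; linarith⟩

theorem exists_lipschitz_near (g : C(I, I)) {e : ℝ} (he : 0 < e) :
    ∃ q : ℝ → ℝ, ∃ K : ℝ, 0 ≤ K ∧ Continuous q ∧ (∀ x : I, |q x - g x| ≤ e) ∧
      ∀ x ∈ I, ∀ y ∈ I, |q x - q y| ≤ K * |x - y| := by
  obtain ⟨p, hp⟩ := exists_polynomial_near_continuousMap 0 1
    ⟨fun x : I => (g x : ℝ), by fun_prop⟩ e he
  have hlip : LocallyLipschitz fun x : ℝ => p.eval x := by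
    have h1 := (Polynomial.contDiff_aeval (𝕜 := ℝ) p 1).locallyLipschitz
    simpa only [Polynomial.coe_aeval_eq_eval] using h1
  obtain ⟨K, hK⟩ := (hlip.locallyLipschitzOn (s := I)).exists_lipschitzOnWith_of_compact
    isCompact_Icc
  refine ⟨fun x => p.eval x, K, K.2, p.continuous, fun x => ?_, fun x hx y hy => ?_⟩
  · exact (ContinuousMap.norm_coe_le_norm _ x).trans hp.le
  · exact hK.dist_le_mul x hx y hy

/-- Adding a triangle wave of high frequency and small amplitude to a Lipschitz approximation of
`g`, and folding the result back into `I`, gives a folded version of `g`. -/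
theorem exists_isFolding (g : C(I, I)) {r : ℝ} (hr : 0 < r) (hr' : r ≤ 1 / 10) :
    ∃ h : C(I, I), ∃ m : ℝ, 0 < m ∧ 2 * m ≤ r ∧ IsFolding h g 4 (2 * m) m (2 * r) ∧
      ∀ x, |(h x : ℝ) - g x| ≤ 5 * r := by
  obtain ⟨q, K, hK0, hq, hqg, hqK⟩ := exists_lipschitz_near g hr
  -- The wave below has slope `16 * r * N`; the factor `4` costs `128 = 4 * 32`, as one passes to a
  -- sixteenth of an interval and loses another factor `2` by folding.
  obtain ⟨N, hN⟩ : ∃ N : ℝ, 0 < N ∧ 2 ≤ r * N ∧ K ≤ r * N ∧ 128 + K ≤ 16 * r * N := by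
    refine ⟨(128 + K) / r, by positivity, ?_, ?_, ?_⟩ <;>
    · try rw [mul_assoc]
      rw [mul_div_cancel₀ _ hr.ne']
      linarith
  obtain ⟨hN0, hN2, hNK, hN128⟩ := hN
  let w : ℝ → ℝ := fun x => q x + 4 * r * (4 * triangleWave (N * x) - 1)
  have hwc : Continuous w := by
    have := continuous_triangleWave
    fun_prop
  have hwg : ∀ x : I, |w x - g x| ≤ 5 * r := by
    intro x
    have h1 := abs_le.1 (hqg x)
    have h2 := triangleWave_nonneg (N * x)
    have h3 := triangleWave_le_half (N * x)
    rw [abs_le]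
    constructor <;> simp only [w] <;> nlinarith
  have hwmem : ∀ x : I, -1 / 2 ≤ w x ∧ w x ≤ 3 / 2 := by
    intro x
    have h1 := abs_le.1 (hwg x)
    have h2 := (g x).2
    exact ⟨by linarith [h2.1], by linarith [h2.2]⟩
  let h : C(I, I) := ⟨fun x => ⟨fold (w x), fold_mem (by linarith [hwmem x]) (by linarith [hwmem x])⟩,
    (continuous_fold.comp (hwc.comp continuous_subtype_val)).subtype_mk _⟩
  have hhx : ∀ x : I, (h x : ℝ) = fold (w x) := fun _ => rfl
  refine ⟨h, 1 / N, by positivity, ?_, ⟨fun a b hab hl => ?_, fun a b hl x hx y hy => ?_⟩,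
    fun x => ?_⟩
  · rw [mul_one_div, div_le_iff₀ hN0]; exact hN2
  · -- Sixteen intervals of equal length subdivide `[a, b]`; one of the first two has no turning
    -- point of the triangle wave.
    have hpos : (0 : ℝ) < b - a := sub_pos.2 hab
    have hlN : N * ((b : ℝ) - a) ≤ 2 := by
      rw [mul_one_div, le_div_iff₀ hN0] at hl; linarith
    set s := ((b : ℝ) - a) / 16 with hs
    have hs0 : 0 < s := by positivity
    obtain ⟨c', hc', hct⟩ := exists_abs_triangleWave_sub (N * a) (s := N * s) (by positivity)
      (by rw [hs]; linarith)
    obtain ⟨c, hcc, hac, hcb⟩ : ∃ c, c' = N * c ∧ (a : ℝ) ≤ c ∧ c + s ≤ b := by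
      rcases hc' with rfl | rfl
      · exact ⟨a, rfl, le_rfl, by linarith⟩
      · exact ⟨a + s, by ring, by linarith, by linarith⟩
    subst hcc
    have ha0 := a.2.1
    have hb1 := b.2.2
    have hcI : c ∈ I := ⟨by linarith, by linarith⟩
    have hdI : c + s ∈ I := ⟨by linarith, by linarith⟩
    have hw : 8 * ((b : ℝ) - a) ≤ |w (c + s) - w c| := by
      have h1 := hqK (c + s) hdI c hcI
      rw [add_sub_cancel_left, abs_of_pos hs0] at h1
      have h2 : w (c + s) - w c = 16 * r * (triangleWave (N * c + N * s) - triangleWave (N * c))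
          + (q (c + s) - q c) := by
        simp only [w, mul_add]; ring
      have h3 : 16 * r * (N * s) ≤ |w (c + s) - w c| + |q (c + s) - q c| := by
        have h4 : |16 * r * (triangleWave (N * c + N * s) - triangleWave (N * c))|
            = 16 * r * (N * s) := by
          rw [abs_mul, hct, abs_of_pos (by positivity)]
        rw [← h4, show 16 * r * (triangleWave (N * c + N * s) - triangleWave (N * c))
          = (w (c + s) - w c) - (q (c + s) - q c) by rw [h2]; ring]
        exact abs_sub _ _
      have h5 : (128 + K) * s ≤ 16 * r * N * s := mul_le_mul_of_nonneg_right hN128 hs0.le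
      have h6 : (b : ℝ) - a = 16 * s := by rw [hs]; ring
      rw [h6]
      nlinarith
    obtain ⟨y₀, hy₀, y₁, hy₁, hy⟩ := exists_fold_sub_ge (p := min (w c) (w (c + s)))
      (q := max (w c) (w (c + s))) min_le_max
      (le_min (hwmem ⟨c, hcI⟩).1 (hwmem ⟨_, hdI⟩).1) (max_le (hwmem ⟨c, hcI⟩).2 (hwmem ⟨_, hdI⟩).2)
    rw [max_sub_min_eq_abs'] at hy
    have himg : ∀ y ∈ Icc (min (w c) (w (c + s))) (max (w c) (w (c + s))),
        ∃ x ∈ Icc a b, w x = y := by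
      intro y hy
      obtain ⟨x, hx, rfl⟩ := intermediate_value_uIcc (hwc.continuousOn (s := uIcc c (c + s))) hy
      rw [uIcc_of_le (by linarith)] at hx
      exact ⟨⟨x, by linarith [hx.1], by linarith [hx.2]⟩,
        ⟨hac.trans hx.1, hx.2.trans hcb⟩, rfl⟩
    obtain ⟨x₀, hx₀, rfl⟩ := himg y₀ hy₀
    obtain ⟨x₁, hx₁, rfl⟩ := himg y₁ hy₁
    refine ⟨x₀, hx₀, x₁, hx₁, ?_⟩
    rw [hhx, hhx]
    rw [abs_sub_comm] at hw
    linarith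
  · -- A full period of the triangle wave next to `x` lies in `[a, b]`.
    have hl0 : 0 < 1 / N := by positivity
    obtain ⟨s, has, hsb, hsx, hxs⟩ : ∃ s : ℝ, a ≤ s ∧ s + 1 / N ≤ b ∧ s ≤ x ∧ x ≤ s + 1 / N := by
      have hxa : (a : ℝ) ≤ x := hx.1
      have hxb : (x : ℝ) ≤ b := hx.2
      rcases le_total (x : ℝ) (b - 1 / N) with h | h
      · exact ⟨x, hxa, by linarith, le_rfl, by linarith⟩
      · exact ⟨b - 1 / N, by linarith, by linarith, h, by linarith⟩
    have hscale : ∀ z ∈ Icc (N * s) (N * s + 1), ∃ u ∈ Icc s (s + 1 / N), N * u = z := by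
      intro z hz
      refine ⟨z / N, ⟨?_, ?_⟩, mul_div_cancel₀ _ hN0.ne'⟩
      · rw [le_div_iff₀ hN0]; linarith [hz.1]
      · rw [div_le_iff₀ hN0, add_mul, one_div_mul_cancel hN0.ne']; linarith [hz.2]
    have hI : ∀ u ∈ Icc s (s + 1 / N), u ∈ I := fun u hu =>
      ⟨a.2.1.trans (has.trans hu.1), hu.2.trans (hsb.trans b.2.2)⟩
    have hqu : ∀ u ∈ Icc s (s + 1 / N), |q u - q x| ≤ r := by
      intro u hu
      refine (hqK u (hI u hu) x x.2).trans ?_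
      have : |u - x| ≤ 1 / N := abs_le.2 ⟨by linarith [hu.1], by linarith [hu.2]⟩
      refine (mul_le_mul_of_nonneg_left this hK0).trans ?_
      rw [mul_one_div, div_le_iff₀ hN0]
      exact hNK
    obtain ⟨z₀, hz₀, ht₀⟩ := exists_triangleWave_eq_zero (N * s)
    obtain ⟨z₁, hz₁, ht₁⟩ := exists_triangleWave_eq_half (N * s)
    obtain ⟨u₀, hu₀, rfl⟩ := hscale z₀ hz₀
    obtain ⟨u₁, hu₁, rfl⟩ := hscale z₁ hz₁
    have hyx := abs_le.1 hy
    have hqx := abs_le.1 (hqg x)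
    have hq₀ := abs_le.1 (hqu u₀ hu₀)
    have hq₁ := abs_le.1 (hqu u₁ hu₁)
    have hmem : (y : ℝ) ∈ uIcc (w u₀) (w u₁) := by
      refine Icc_subset_uIcc ⟨?_, ?_⟩
      · simp only [w, ht₀]; linarith
      · simp only [w, ht₁]; linarith
    obtain ⟨u, hu, huy⟩ := intermediate_value_uIcc (hwc.continuousOn (s := uIcc u₀ u₁)) hmem
    have hu' := uIcc_subset_Icc hu₀ hu₁ hu
    refine ⟨⟨u, hI u hu'⟩, ⟨has.trans hu'.1, hu'.2.trans hsb⟩, Subtype.ext ?_⟩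
    rw [hhx]
    simp only [huy]
    exact fold_of_mem y.2
  · have h1 := abs_fold_sub_le (w x) (g x)
    rw [fold_of_mem (g x).2] at h1
    exact h1.trans (hwg x)

/-! ### Prescribing the value at the endpoint `0` -/

/-- The value at `0` of a folded version of `g` can be moved to any point at distance at least `r`
by replacing the map with an affine one on a short interval `[0, δ]`; the affine piece is steep, so
the expansion of short intervals survives. -/
theorem IsFolding.exists_apply_zero_eq {h g : C(I, I)} {m r : ℝ}
    (H : IsFolding h g 4 (2 * m) m (2 * r)) (hm : 0 < m) (hr : 0 < r) (v : I)
    (hv : r ≤ |(v : ℝ) - h 0|) {d : ℝ} (hd : 0 < d) :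
    ∃ h' : C(I, I), h' 0 = v ∧ (∀ x : I, d ≤ x → h' x = h x) ∧
      (∀ x : I, |(h' x : ℝ) - h x| ≤ |(v : ℝ) - h 0| + r) ∧ IsFolding h' g 2 (2 * m) (2 * m) r := by
  obtain ⟨δ₁, hδ₁, hh⟩ := Metric.continuous_iff'.1 h.continuous 0 (r / 2) (half_pos hr)
    |> Metric.eventually_nhds_iff.1
  obtain ⟨δ₂, hδ₂, hg⟩ := Metric.uniformContinuous_iff.1
    (CompactSpace.uniformContinuous_of_continuous g.continuous) r hr
  obtain ⟨δ, hδ0, hδ1, hδd, hδm, hδr, hδδ₁, hδδ₂⟩ : ∃ δ : ℝ, 0 < δ ∧ δ ≤ 1 ∧ δ ≤ d ∧ δ ≤ m ∧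
      8 * δ ≤ r ∧ δ < δ₁ ∧ δ < δ₂ := by
    obtain ⟨δ, h0, h1⟩ := exists_between
      (show 0 < min 1 (min d (min m (min (r / 8) (min δ₁ δ₂)))) by positivity)
    simp only [lt_min_iff] at h1
    exact ⟨δ, h0, h1.1.le, h1.2.1.le, h1.2.2.1.le, by linarith [h1.2.2.2.1], h1.2.2.2.2.1,
      h1.2.2.2.2.2⟩
  let c : I := ⟨δ, hδ0.le, hδ1⟩
  have hc : (c : ℝ) = δ := rfl
  have hnear : ∀ x : I, (x : ℝ) ≤ δ → |(h x : ℝ) - h 0| ≤ r / 2 := by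
    intro x hx
    refine (hh (y := x) ?_).le
    rw [Subtype.dist_eq, Real.dist_eq, Icc.coe_zero, sub_zero, abs_of_nonneg x.2.1]
    linarith
  let u : I → ℝ := fun x => if (x : ℝ) ≤ δ then (1 - x / δ) * v + x / δ * h c else h x
  have hu : Continuous u := by
    refine Continuous.if_le (by fun_prop) (by fun_prop) (by fun_prop) continuous_const ?_
    intro x hx
    have : x = c := Subtype.ext hx
    rw [this, hc, div_self hδ0.ne']
    ring
  have hquot : ∀ x : I, (x : ℝ) ≤ δ → 0 ≤ (x : ℝ) / δ ∧ (x : ℝ) / δ ≤ 1 := fun x hx =>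
    ⟨div_nonneg x.2.1 hδ0.le, (div_le_one hδ0).2 hx⟩
  have humem : ∀ x, u x ∈ I := by
    intro x
    by_cases hx : (x : ℝ) ≤ δ
    · simp only [u, if_pos hx]
      exact convex_Icc (0 : ℝ) 1 v.2 (h c).2 (by linarith [hquot x hx]) (hquot x hx).1 (by ring)
    · simp only [u, if_neg hx]
      exact (h x).2
  let h' : C(I, I) := ⟨fun x => ⟨u x, humem x⟩, hu.subtype_mk _⟩
  have hle : ∀ x : I, (x : ℝ) ≤ δ → (h' x : ℝ) = (1 - x / δ) * v + x / δ * h c :=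
    fun x hx => if_pos hx
  have hge : ∀ x : I, δ ≤ x → h' x = h x := by
    intro x hx
    rcases hx.eq_or_lt with hx | hx
    · have hxc : x = c := Subtype.ext hx.symm
      apply Subtype.ext
      rw [hle x hx.ge, ← hx, div_self hδ0.ne', hxc]
      ring
    · exact Subtype.ext (if_neg (not_le.2 hx))
  have himg : ∀ a' b : I, δ ≤ a' → h' '' Icc a' b = h '' Icc a' b := fun a' b ha' =>
    image_congr fun x hx => hge x (ha'.trans hx.1)
  refine ⟨h', ?_, fun x hx => hge x (hδd.trans hx), fun x => ?_, ⟨fun a b hab hl => ?_,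
    fun a b hl x hx y hy => ?_⟩⟩
  · apply Subtype.ext
    rw [hle 0 hδ0.le]
    simp
  · rcases le_total (x : ℝ) δ with hx | hx
    · have h1 := abs_le.1 (hnear x hx)
      have h2 := abs_le.1 (hnear c le_rfl)
      obtain ⟨h3, h4⟩ := hquot x hx
      have h5 := abs_le.1 (le_refl |(v : ℝ) - h 0|)
      have h6 : 0 ≤ |(v : ℝ) - h 0| := abs_nonneg _
      rw [hle x hx, show (1 - (x : ℝ) / δ) * v + x / δ * h c - h x
        = (1 - x / δ) * (v - h x) + x / δ * (h c - h x) by ring]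
      refine abs_le.2 (convex_Icc (-(|(v : ℝ) - h 0| + r)) (|(v : ℝ) - h 0| + r) (x := v - h x)
        (y := h c - h x) ⟨by linarith, by linarith⟩ ⟨by linarith, by linarith⟩
        (by linarith) h3 (by ring))
    · rw [hge x hx, sub_self, abs_zero]
      positivity
  · have hpos : (0 : ℝ) < b - a := sub_pos.2 hab
    rcases le_total δ (((a : ℝ) + b) / 2) with hδab | hδab
    · have hcb : c < b := by
        rw [← Subtype.coe_lt_coe, hc]; linarith
      have hmax : ((max a c : I) : ℝ) = max (a : ℝ) δ := by
        rcases le_total a c with h0 | h0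
        · rw [max_eq_right h0, max_eq_right (show (a : ℝ) ≤ δ from h0)]
        · rw [max_eq_left h0, max_eq_left (show δ ≤ (a : ℝ) from h0)]
      have hmid : max (a : ℝ) δ ≤ (a + b) / 2 := max_le (by linarith) hδab
      have ha := le_max_left (a : ℝ) δ
      obtain ⟨x, hx, y, hy, hxy⟩ := H.short (max a c) b (max_lt hab hcb) (by rw [hmax]; linarith)
      rw [hmax] at hxy
      refine ⟨x, ⟨(le_max_left _ _).trans hx.1, hx.2⟩, y, ⟨(le_max_left _ _).trans hy.1, hy.2⟩, ?_⟩
      rw [hge x ((le_max_right a c).trans hx.1), hge y ((le_max_right a c).trans hy.1)]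
      linarith
    · have hac : a ≤ c := by
        rw [← Subtype.coe_le_coe, hc]; linarith
      obtain ⟨e, hae, heb, hec, hee⟩ : ∃ e : I, a ≤ e ∧ e ≤ b ∧ (e : ℝ) ≤ δ ∧
          ((b : ℝ) - a) / 2 ≤ e - a := by
        rcases le_total b c with hbc | hbc
        · exact ⟨b, hab.le, le_rfl, hbc, by linarith⟩
        · exact ⟨c, hac, hbc, le_rfl, by rw [hc]; linarith⟩
      have hdiff : (h' e : ℝ) - h' a = (e - a) / δ * (h c - v) := by
        rw [hle e hec, hle a hac]; ring
      have hslope : 4 * δ ≤ |(h c : ℝ) - v| := by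
        have h1 := hnear c le_rfl
        have h2 := abs_sub_le (v : ℝ) (h c) (h 0)
        rw [abs_sub_comm (v : ℝ) (h c)] at h2
        linarith
      have habs : 2 * ((b : ℝ) - a) ≤ |(h' e : ℝ) - h' a| := by
        have hea : (0 : ℝ) ≤ e - a := by linarith
        rw [hdiff, abs_mul, abs_of_nonneg (div_nonneg hea hδ0.le), div_mul_eq_mul_div,
          le_div_iff₀ hδ0]
        nlinarith [mul_le_mul_of_nonneg_left hslope hea]
      have ham : a ∈ Icc a b := ⟨le_rfl, hab.le⟩
      rcases le_total 0 ((h' e : ℝ) - h' a) with h0 | h0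
      · exact ⟨a, ham, e, ⟨hae, heb⟩, by rwa [abs_of_nonneg h0] at habs⟩
      · refine ⟨e, ⟨hae, heb⟩, a, ham, ?_⟩
        rw [abs_of_nonpos h0] at habs
        linarith
  · obtain ⟨a', haa', ha'δ, ha'⟩ : ∃ a' : I, a ≤ a' ∧ δ ≤ a' ∧ (a' : ℝ) ≤ a + δ := by
      rcases le_total (a : ℝ) δ with h0 | h0
      · exact ⟨c, h0, le_rfl, by rw [hc]; linarith [a.2.1]⟩
      · exact ⟨a, le_rfl, h0, by linarith⟩
    have ha'b : a' ≤ b := by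
      rw [← Subtype.coe_le_coe]; linarith
    obtain ⟨x', hx', hxx'⟩ : ∃ x' ∈ Icc a' b, |(x' : ℝ) - x| ≤ δ := by
      have hxa : (a : ℝ) ≤ x := hx.1
      rcases le_total x a' with h0 | h0
      · refine ⟨a', ⟨le_rfl, ha'b⟩, ?_⟩
        have h1 : (x : ℝ) ≤ a' := h0
        rw [abs_of_nonneg (by linarith)]
        linarith
      · exact ⟨x, ⟨h0, hx.2⟩, by rw [sub_self, abs_zero]; exact hδ0.le⟩
    have hgx : |(g x : ℝ) - g x'| ≤ r := by
      rw [abs_sub_comm]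
      exact (hg (show dist x' x < δ₂ from hxx'.trans_lt hδδ₂)).le
    have hy' : y ∈ h '' Icc a' b := H.long a' b (by linarith) x' hx' y (by
      have := abs_sub_le (y : ℝ) (g x) (g x')
      linarith)
    rw [← himg a' b ha'δ] at hy'
    exact image_mono (Icc_subset_Icc_left haa') hy'

/-- If `h'` agrees with `h` away from `0` and the `h`-orbit of `v = h' 0` stays away from `0`, then
that orbit is the `h'`-orbit of `0` from its second point on. -/
theorem iterate_succ_zero_eq {h h' : I → I} {v : I} {d : ℝ} (h0 : h' 0 = v)
    (hd : ∀ x : I, d ≤ x → h' x = h x) {n : ℕ} (hv : ∀ j < n, d ≤ (h^[j] v : ℝ)) :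
    h'^[n + 1] 0 = h^[n] v := by
  induction n with
  | zero => simpa using h0
  | succ n ih =>
    rw [iterate_succ_apply', ih fun j hj => hv j (by omega), hd _ (hv n (by omega)),
      iterate_succ_apply']

/-- Near every map in the closure of `CP`, two maps in `CP` order a pair of points of the forward
orbit of `0` in opposite ways. -/
theorem exists_iterate_zero_lt_and_gt {g : C(I, I)} {O : Set C(I, I)} (hO : IsOpen O) (hgO : g ∈ O)
    (hg : g ∈ closure CP) : ∃ h₁ ∈ O ∩ CP, ∃ h₂ ∈ O ∩ CP, ∃ i j : ℕ,
      h₁^[i] 0 < h₁^[j] 0 ∧ h₂^[j] 0 < h₂^[i] 0 := by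
  obtain ⟨g, hgO, hg⟩ := mem_closure_iff.1 hg O hO hgO
  obtain ⟨ε, hε, hball⟩ := Metric.isOpen_iff.1 hO g hgO
  obtain ⟨r, hr, hr'⟩ := exists_between (show 0 < min (1 / 10) (ε / 8) by positivity)
  rw [lt_min_iff] at hr'
  obtain ⟨h, m, hm, hmr, H, hhg⟩ := exists_isFolding g hr hr'.1.le
  have hleo : IsLeo h := by
    have H' : IsFolding h g 2 (2 * m) (2 * m) r :=
      ⟨fun a b hab hl => by
        obtain ⟨x, hx, y, hy, hxy⟩ := H.short a b hab hl
        have : (0 : ℝ) < b - a := sub_pos.2 hab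
        exact ⟨x, hx, y, hy, by linarith⟩,
      fun a b hl x hx y hy => H.long a b (by linarith) x hx y (by linarith)⟩
    exact H'.isLeo h.continuous hg (by linarith) hmr (by linarith)
  -- An interval of admissible values at `0`.
  obtain ⟨α, β, hαβ, hval⟩ : ∃ α β : I, α < β ∧
      ∀ v ∈ Icc α β, r ≤ |(v : ℝ) - h 0| ∧ |(v : ℝ) - h 0| ≤ 2 * r := by
    have h0 := (h 0).2
    rcases le_total (h 0 : ℝ) (1 / 2) with hh | hh
    · refine ⟨⟨h 0 + r, by linarith [h0.1], by linarith⟩, ⟨h 0 + 2 * r, by linarith [h0.1],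
        by linarith⟩, ?_, fun v hv => ?_⟩
      · rw [← Subtype.coe_lt_coe]; simp only; linarith
      · have h1 : (h 0 : ℝ) + r ≤ v := hv.1
        have h2 : (v : ℝ) ≤ h 0 + 2 * r := hv.2
        rw [abs_of_nonneg (by linarith)]
        constructor <;> linarith
    · refine ⟨⟨h 0 - 2 * r, by linarith, by linarith [h0.2]⟩, ⟨h 0 - r, by linarith,
        by linarith [h0.2]⟩, ?_, fun v hv => ?_⟩
      · rw [← Subtype.coe_lt_coe]; simp only; linarith
      · have h1 : (h 0 : ℝ) - 2 * r ≤ v := hv.1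
        have h2 : (v : ℝ) ≤ h 0 - r := hv.2
        rw [abs_of_nonpos (by linarith)]
        constructor <;> linarith
  obtain ⟨a, hαa, haβ⟩ := exists_between hαβ
  obtain ⟨b, hab, hbβ⟩ := exists_between haβ
  obtain ⟨n, hn⟩ := hleo a b hab
  -- Any open condition on the `n + 1`st point of the orbit of `0` can be realized.
  have key : ∀ W : Set I, IsOpen W → W.Nonempty →
      ∃ h' ∈ O ∩ CP, h'^[n + 1] 0 ∈ W ∧ h'^[n + 2] 0 = h (h'^[n + 1] 0) := by
    rintro W hW ⟨z, hz⟩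
    obtain ⟨y, hy, rfl⟩ : z ∈ h^[n] '' Icc a b := hn ▸ mem_univ z
    have hopen : IsOpen (Ioo α β ∩ h^[n] ⁻¹' W) :=
      isOpen_Ioo.inter (hW.preimage (h.continuous.iterate n))
    obtain ⟨v, ⟨hvαβ, hvW⟩, hv0⟩ := (hleo.dense_forall_iterate_ne 0).inter_open_nonempty _ hopen
      ⟨y, ⟨hαa.trans_le hy.1, hy.2.trans_lt hbβ⟩, hz⟩
    obtain ⟨d, hd, hvd⟩ : ∃ d : ℝ, 0 < d ∧ ∀ j < n + 1, d ≤ (h^[j] v : ℝ) := by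
      obtain ⟨j₀, -, hj₀⟩ := (Finset.range (n + 1)).exists_min_image
        (fun j => (h^[j] v : ℝ)) ⟨0, by simp⟩
      exact ⟨_, unitInterval.pos_iff_ne_zero.2 (hv0 j₀), fun j hj => hj₀ j (by simpa using hj)⟩
    obtain ⟨hv1, hv2⟩ := hval v (Ioo_subset_Icc_self hvαβ)
    obtain ⟨h', h'0, h'd, h'h, H'⟩ := H.exists_apply_zero_eq hm hr v hv1 hd
    have h'leo : IsLeo h' := H'.isLeo h'.continuous hg (by linarith) hmr (by linarith)
    have e1 : h'^[n + 1] 0 = h^[n] v :=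
      iterate_succ_zero_eq h'0 h'd fun j hj => hvd j (by omega)
    have e2 : h'^[n + 2] 0 = h^[n + 1] v := iterate_succ_zero_eq h'0 h'd hvd
    refine ⟨h', ⟨hball ?_, h'leo.mem_CP⟩, e1 ▸ hvW, by rw [e2, e1, iterate_succ_apply']⟩
    refine (ContinuousMap.dist_le (by positivity : 0 ≤ 8 * r)).2 (fun x => ?_) |>.trans_lt
      (by linarith [hr'.2])
    rw [Subtype.dist_eq, Real.dist_eq]
    have := abs_sub_le (h' x : ℝ) (h x) (g x)
    linarith [h'h x, hhg x]
  obtain ⟨h₁, hh₁, hW₁, e₁⟩ := key {x | x < h x} (isOpen_lt continuous_id h.continuous)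
    hleo.exists_lt_apply
  obtain ⟨h₂, hh₂, hW₂, e₂⟩ := key {x | h x < x} (isOpen_lt h.continuous continuous_id)
    hleo.exists_apply_lt
  exact ⟨h₁, hh₁, h₂, hh₂, n + 1, n + 2, e₁ ▸ hW₁, e₂ ▸ hW₂⟩

/-! ### Conjugacy classes -/

theorem conjugacyClass_subset_closure_CP {f : C(I, I)} (hf : f ∈ closure CP) :
    conjugacyClass f ⊆ closure CP := by
  rintro g ⟨ψ, hψ⟩
  let Φ : C(I, I) → C(I, I) := fun k =>
    (ContinuousMap.comp ⟨ψ.symm, ψ.symm.continuous⟩ k).comp ⟨ψ, ψ.continuous⟩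
  have hΦ : Continuous Φ :=
    (ContinuousMap.continuous_precomp _).comp (ContinuousMap.continuous_postcomp _)
  have hg : g = Φ f := ContinuousMap.ext hψ
  rw [hg]
  refine map_mem_closure hΦ hf fun k hk => ⟨?_, ?_⟩
  · exact (ψ.symm.surjective.comp hk.1).comp ψ.surjective
  · have hsemi : Semiconj ψ.symm k (Φ k) := fun x => by simp [Φ]
    exact (ψ.symm.surjective.denseRange.dense_image ψ.symm.continuous hk.2).mono
      hsemi.mapsTo_periodicPts.image_subset

theorem iterate_conj_zero {f g : C(I, I)} {ψ : I ≃ₜ I} (h : ∀ x, g x = ψ.symm (f (ψ x))) (n : ℕ) :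
    ψ (g^[n] 0) = f^[n] (ψ 0) :=
  (show Semiconj ψ g f from fun x => by simp [h]).iterate_right n 0

/-- The order type of the forward orbit of `0` takes at most two values on a conjugacy class, one
for increasing and one for decreasing conjugacies. -/
theorem exists_orbit_order_of_mem_conjugacyClass {f g : C(I, I)} (hg : g ∈ conjugacyClass f) :
    (∀ i j : ℕ, g^[i] 0 < g^[j] 0 ↔ f^[i] 0 < f^[j] 0) ∨
      ∀ i j : ℕ, g^[i] 0 < g^[j] 0 ↔ f^[j] 1 < f^[i] 1 := by
  obtain ⟨ψ, hψ⟩ := hg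
  rcases ψ.continuous.strictMono_of_inj_boundedOrder' ψ.injective with h | h
  · have h0 : ψ 0 = 0 := le_antisymm (by
      obtain ⟨x, hx⟩ := ψ.surjective 0
      exact (h.monotone (unitInterval.nonneg' (t := x))).trans hx.le) unitInterval.nonneg'
    left
    intro i j
    rw [← h.lt_iff_lt, iterate_conj_zero hψ, iterate_conj_zero hψ, h0]
  · have h0 : ψ 0 = 1 := le_antisymm unitInterval.le_one' (by
      obtain ⟨x, hx⟩ := ψ.surjective 1
      exact hx.ge.trans (h.antitone (unitInterval.nonneg' (t := x))))
    right
    intro i j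
    rw [← h.lt_iff_gt, iterate_conj_zero hψ, iterate_conj_zero hψ, h0]

theorem isOpen_setOf_iterate_lt (i j : ℕ) : IsOpen {g : C(I, I) | g^[i] 0 < g^[j] 0} := by
  have hcont : ∀ n : ℕ, Continuous fun g : C(I, I) => g^[n] 0 := by
    intro n
    induction n with
    | zero => exact continuous_const
    | succ n ih =>
      simp only [iterate_succ_apply']
      exact continuous_eval.comp (continuous_id.prodMk ih)
  exact isOpen_lt (hcont i) (hcont j)

/-- For every `f` in the closure of `CP`, the conjugacy class of `f` is a subset of that closure,
and it is nowhere dense in it (with respect to the subspace topology of the closure). -/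
theorem theorem5p7 (f : C(unitInterval, unitInterval)) (hf : f ∈ closure CP) :
    conjugacyClass f ⊆ closure CP ∧
      IsNowhereDense {g : ↥(closure CP) | (g : C(unitInterval, unitInterval)) ∈ conjugacyClass f} := by
  refine ⟨conjugacyClass_subset_closure_CP hf, ?_⟩
  rw [IsNowhereDense, eq_empty_iff_forall_notMem]
  intro g hg
  obtain ⟨U, hU, hUO, hgU⟩ := mem_interior.1 hg
  obtain ⟨O, hO, rfl⟩ := isOpen_induced_iff.1 hUO
  -- Every open set that meets `O ∩ CP` contains conjugates of `f`.
  have hconj : ∀ V : Set C(I, I), IsOpen V → ∀ h ∈ O ∩ CP, h ∈ V →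
      ∃ k ∈ V, k ∈ conjugacyClass f := by
    intro V hV h hh hhV
    obtain ⟨k, hkV, hk⟩ := mem_closure_iff.1 (hU (show (⟨h, subset_closure hh.2⟩ : closure CP) ∈ _
      from hh.1)) (Subtype.val ⁻¹' V) (hV.preimage continuous_subtype_val) hhV
    exact ⟨k, hkV, hk⟩
  obtain ⟨h₁, hh₁, h₂, hh₂, i, j, hlt₁, hlt₂⟩ := exists_iterate_zero_lt_and_gt hO hgU g.2
  obtain ⟨h₃, hh₃, h₄, hh₄, i', j', hlt₃, hlt₄⟩ := exists_iterate_zero_lt_and_gt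
    (hO.inter (isOpen_setOf_iterate_lt j i)) ⟨hh₂.1, hlt₂⟩ (subset_closure hh₂.2)
  obtain ⟨k₁, hk₁, hkf₁⟩ := hconj _ (isOpen_setOf_iterate_lt i j) h₁ hh₁ hlt₁
  obtain ⟨k₃, ⟨hk₃, hk₃'⟩, hkf₃⟩ := hconj _ ((isOpen_setOf_iterate_lt j i).inter
    (isOpen_setOf_iterate_lt i' j')) h₃ ⟨hh₃.1.1, hh₃.2⟩ ⟨hh₃.1.2, hlt₃⟩
  obtain ⟨k₄, ⟨hk₄, hk₄'⟩, hkf₄⟩ := hconj _ ((isOpen_setOf_iterate_lt j i).inter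
    (isOpen_setOf_iterate_lt j' i')) h₄ ⟨hh₄.1.1, hh₄.2⟩ ⟨hh₄.1.2, hlt₄⟩
  simp only [mem_ofPred_eq] at hk₁ hk₃ hk₃' hk₄ hk₄'
  -- The orbits of `0` under these three conjugates are pairwise ordered differently.
  rcases exists_orbit_order_of_mem_conjugacyClass hkf₁ with e₁ | e₁ <;>
  rcases exists_orbit_order_of_mem_conjugacyClass hkf₃ with e₃ | e₃ <;>
  rcases exists_orbit_order_of_mem_conjugacyClass hkf₄ with e₄ | e₄ <;>
  rw [e₁] at hk₁ <;> rw [e₃] at hk₃ hk₃' <;> rw [e₄] at hk₄ hk₄' <;>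
  first
  | exact lt_asymm hk₁ hk₃
  | exact lt_asymm hk₁ hk₄
  | exact lt_asymm hk₃' hk₄'
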